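/- Let $K\ge 2$ and let $X_1,\dots,X_K$ be memoryless Bernoulli sources (arms) with parameters $p_i=p_i(1)=\mathbb P[X_i=1]\in[0,\tfrac12]$. Write $h_b(p)=-p\log p-(1-p)\log(1-p)$ (natural logarithm), $H_i=h_b(p_i)$, $H_{i^*}=\max_i H_i$ and $\Delta_i=H_{i^*}-H_i$. In round $t=1,2,\dots$ a player chooses an arm $I(t)$, on the basis of the information available before round $t$, and observes the symbol $X_{I(t)}(t)$. Let $N_i(t)$ be the number of plays of arm $i$ in rounds $1,\dots,t$, let $\hat p_i(t)$ be the fraction of symbols $1$ among the $N_i(t)$ symbols observed from arm $i$ up to round $t$, and let $R(t)=t\,H_{i^*}-\sum_{i=1}^K\mathbb E[N_i(t)]\,H_i$ be the pseudo-regret. For $n\ge1$ put $$\mathrm{UCD}_{\rm ber}(q,\delta,n)=\sqrt{\frac{12\,q\log(6/\delta)}{n}}\;\log\frac{n}{q\log(6/\delta)}+\frac{18\log(6/\delta)\log n}{n}$$ (the first summand being $0$ if $q=0$), let $\Lambda_1(s)=s\log s$ (with $\Lambda_1(0)=0$), and $$\Gamma_{\rm ber}(\alpha,\beta,q,\Delta,t)=\max\Big\{6\,\Lambda_1\Big(\frac{36\alpha\log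 t}{(1-\beta)\Delta}\Big),\ \frac{5120\,q\,\alpha\log t}{\beta^2\Delta^2}\log^2\frac{48}{\beta^2\Delta^2},\ \frac{88\sqrt{\alpha\log t}}{\beta\Delta}\log\frac{48}{\beta^2\Delta^2}\Big\}.$$ Let $\alpha>2$ and $\delta_\alpha(t)=6t^{-\alpha}$. Suppose that the player first plays each arm three times (in any order) and that, in every later round $t$, $$I(t)\in\arg\max_i\Big\{h_b(\hat p_i(t-1))+\mathrm{UCD}_{\rm ber}\big(\hat p_i(t-1),\delta_\alpha(t),N_i(t-1)\big)\Big\},$$ ties being broken arbitrarily. Then, for every $t\ge1$, $$R(t)\le\sum_{i:\Delta_i>0}\ \inf_{\beta\in(0,1)}\Big[\Gamma_{\rm ber}(\alpha,\beta,p_i,\Delta_i,t)\,\Delta_i+\frac{16(\alpha-1)}{\alpha-2}\,\Delta_i\Big].$$ Moreover, up to a logarithmic factor, the leading term of $\Gamma_{\rm ber}$ for small gaps is of order $q\log t/\Delta^2$: for all $\alpha>2$ and $\beta\in(0,1)$ there is a constant $C=C(\alpha,\beta)$ such that, for all integers $t\ge3$, all $q\in[0,\tfrac12]$ and all $\Delta\in(0,\log2]$,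 $$\Big|\Gamma_{\rm ber}(\alpha,\beta,q,\Delta,t)-\frac{5120\,\alpha}{\beta^2}\cdot\frac{q\log t}{\Delta^2}\,\log^2\frac{48}{\beta^2\Delta^2}\Big|\le C\,\frac{\log t}{\Delta}\,\log\frac{\log t}{\Delta}.$$ -/

import Mathlib

open MeasureTheory ProbabilityTheory

noncomputable section

/-! ## The bandit game

Rounds are numbered `1, 2, …`; the values at round `0` of the sources `X` and of the
choices `I` are never used. -/

/-- `N_i(t)`: the number of rounds `τ ∈ {1, …, t}` in which arm `i` was played. -/
def playCount {Ω : Type*} {K : ℕ} (I : ℕ → Ω → Fin K) (i : Fin K) (t : ℕ) (ω : Ω) : ℕ :=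
  ((Finset.Icc 1 t).filter (fun τ => I τ ω = i)).card

/-- `𝑿_i(t)`: the list of symbols observed from arm `i` in the rounds `1, …, t`. -/
def observed {Ω 𝒴 : Type*} {K : ℕ} (X : Fin K → ℕ → Ω → 𝒴) (I : ℕ → Ω → Fin K)
    (i : Fin K) : ℕ → Ω → List 𝒴
  | 0, _ => []
  | t + 1, ω =>
      if I (t + 1) ω = i then observed X I i t ω ++ [X i (t + 1) ω] else observed X I i t ω

/-- `X` is a family of memoryless Bernoulli sources with parameters `p i = ℙ[X_i = 1]`
(the symbol `1` is `true`). `ℱ t` is the information available after round `t`: it contains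
all the symbols of the rounds up to `t`, and possibly additional randomness, such as that used
to break ties. The symbol of a source in a round is independent of the information available
before that round. -/
structure IsBernoulliSources {Ω : Type*} {mΩ : MeasurableSpace Ω} (P : Measure Ω)
    (ℱ : Filtration ℕ mΩ) {K : ℕ} (p : Fin K → ℝ) (X : Fin K → ℕ → Ω → Bool) : Prop where
  adapted : ∀ i t, 1 ≤ t → Measurable[ℱ t] (X i t)
  law : ∀ i t, 1 ≤ t → P.real {ω | X i t ω = true} = p i
  memoryless : ∀ i t, Indep (MeasurableSpace.comap (X i (t + 1)) inferInstance) (ℱ t) P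

/-- `I` is a run of the upper confidence bound algorithm with entropy estimator `Hhat`,
upper confidence deviation `UCD` and confidence function `δ`, started by playing every arm
`m` times (in any order): as long as some arm has been played fewer than `m` times, such an
arm is played; afterwards, the arm played maximizes the estimate plus the deviation, with
ties broken arbitrarily. The choice at a round only uses the information available before
that round. -/
structure IsUCBRun {Ω 𝒴 : Type*} {mΩ : MeasurableSpace Ω} (ℱ : Filtration ℕ mΩ) {K : ℕ}
    (X : Fin K → ℕ → Ω → 𝒴) (m : ℕ) (Hhat : List 𝒴 → ℕ → ℝ) (UCD : List 𝒴 → ℝ → ℕ → ℝ)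
    (δ : ℕ → ℝ) (I : ℕ → Ω → Fin K) : Prop where
  predictable : ∀ t, Measurable[ℱ t] (I (t + 1))
  initial : ∀ t ω, (∃ j, playCount I j t ω < m) → playCount I (I (t + 1) ω) t ω < m
  argmax : ∀ t ω, (∀ j, m ≤ playCount I j t ω) → ∀ j,
    Hhat (observed X I j t ω) (playCount I j t ω)
        + UCD (observed X I j t ω) (δ (t + 1)) (playCount I j t ω) ≤
      Hhat (observed X I (I (t + 1) ω) t ω) (playCount I (I (t + 1) ω) t ω)
        + UCD (observed X I (I (t + 1) ω) t ω) (δ (t + 1)) (playCount I (I (t + 1) ω) t ω)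

/-! ## Rewards, gaps and regret for Bernoulli arms -/

/-- `H_{i*}`: the largest entropy of an arm (natural logarithm). -/
def bestEntropy {K : ℕ} (p : Fin K → ℝ) : ℝ := ⨆ i, Real.binEntropy (p i)

/-- `Δ_i = H_{i*} - H_i`. -/
def gap {K : ℕ} (p : Fin K → ℝ) (i : Fin K) : ℝ := bestEntropy p - Real.binEntropy (p i)

/-- The expected pseudo-regret `R(t) = t H_{i*} - ∑ i, 𝔼[N_i(t)] H_i`. -/
def pseudoRegret {Ω : Type*} {mΩ : MeasurableSpace Ω} (P : Measure Ω) {K : ℕ}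
    (p : Fin K → ℝ) (I : ℕ → Ω → Fin K) (t : ℕ) : ℝ :=
  t * bestEntropy p - ∑ i, (∫ ω, (playCount I i t ω : ℝ) ∂P) * Real.binEntropy (p i)

/-! ## The estimator, the deviation and the bound -/

/-- `p̂(𝒀, n)`: the empirical probability of the symbol `1` in the `n` samples `𝒀`. -/
def empProb (Y : List Bool) (n : ℕ) : ℝ := (Y.count true : ℝ) / n

/-- `UCD_ber(q, δ, n)`; at `q = 0` the first summand is `0`, its limit as `q ↓ 0`. -/
def ucdBer (q δ : ℝ) (n : ℕ) : ℝ :=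
  √(12 * q * Real.log (6 / δ) / n) * Real.log (n / (q * Real.log (6 / δ)))
    + 18 * Real.log (6 / δ) * Real.log n / n

/-- `Λ_k(s) = s log^k s`. -/
def polylogLin (k : ℕ) (s : ℝ) : ℝ := s * Real.log s ^ k

/-- `Γ_ber(α, β, q, Δ, t)`. -/
def gammaBer (α β q Δ t : ℝ) : ℝ :=
  max (6 * polylogLin 1 (36 * α * Real.log t / ((1 - β) * Δ)))
    (max (5120 * q * α * Real.log t / (β ^ 2 * Δ ^ 2) * Real.log (48 / (β ^ 2 * Δ ^ 2)) ^ 2)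
      (88 * √(α * Real.log t) / (β * Δ) * Real.log (48 / (β ^ 2 * Δ ^ 2))))

end

/-! By `pseudoRegret_eq` the regret is the sum of `𝔼[N_i] Δ_i`, so it suffices to bound the expected
number of plays of each suboptimal arm. Write `η(x) = -x log x` and `a = L / n`, where `L = α log(τ
+ 1) = log(6 / δ)`.

For each `n`, the event that an arm has `n` samples and `|p̂ - p| > 2√(pa) + 2a` has probability at
most `2 exp(-L)` (`measure_deviationSet_le`). This is Bernstein's inequality, run on an exponential
supermartingale because the sample size is random. A union over `n ≤ τ` and two arms, summed over
`τ`, costs at most `4 / (α - 2)`.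

A deviation of this size raises the entropy by at most `16 η(a) + 6 η(√(xa))`
(`binEntropy_le_of_le_add`), which is the shape of the confidence deviation. So, on typical rounds,
the index of a best arm is at least `H_{i*}` (`binEntropy_le_add_ucdBer`), while the index of an arm
played more than `Γ` times is below `H_i + Δ_i = H_{i*}` (`binEntropy_add_ucdBer_lt`). Such an arm
is therefore played only on atypical rounds. The variance scale `√(pa)`, in place of `√a`, puts the
factor `q` in the leading term.

The second claim compares a maximum with one of its entries, the other two being of lower order. -/

/-! ### Moduli of continuity of `x log x` and of the binary entropy. -/

lemma exp_one_le_three : Real.exp 1 ≤ 3 := by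
  have := Real.exp_one_lt_d9; linarith

lemma one_le_log_of_three_le {x : ℝ} (hx : 3 ≤ x) : 1 ≤ Real.log x := by
  rw [Real.le_log_iff_exp_le (by linarith)]
  exact exp_one_le_three.trans hx

lemma sqrt_add_le_sqrt_add {x y : ℝ} (hx : 0 ≤ x) (hy : 0 ≤ y) : √(x + y) ≤ √x + √y := by
  rw [Real.sqrt_le_left (by positivity)]
  nlinarith [Real.sq_sqrt hx, Real.sq_sqrt hy, mul_nonneg (Real.sqrt_nonneg x) (Real.sqrt_nonneg y)]

lemma log_le_neg_one {x : ℝ} (h0 : 0 < x) (hx : x ≤ 1 / 3) : Real.log x ≤ -1 := by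
  have := one_le_log_of_three_le (x := x⁻¹) (by rw [le_inv_comm₀ (by norm_num) h0]; linarith)
  rw [Real.log_inv] at this
  linarith

/-- The function increases up to `1 / e`; `1 / 3` is a rational stand-in. -/
lemma negMulLog_mono {x y : ℝ} (hx : 0 ≤ x) (hxy : x ≤ y) (hy : y ≤ 1 / 3) :
    Real.negMulLog x ≤ Real.negMulLog y := by
  rcases hx.eq_or_lt with rfl | hx
  · simpa using Real.negMulLog_nonneg hxy (by linarith)
  have hy0 : 0 < y := hx.trans_le hxy
  have h1 := log_le_neg_one hy0 hy
  have h2 := Real.log_le_sub_one_of_pos (div_pos hy0 hx)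
  rw [Real.log_div hy0.ne' hx.ne'] at h2
  have h3 : x * (Real.log y - Real.log x) ≤ y - x := by
    calc _ ≤ x * (y / x - 1) := by gcongr
      _ = y - x := by field_simp
  simp only [Real.negMulLog]
  nlinarith [mul_nonneg (sub_nonneg.2 hxy) (by linarith : 0 ≤ -1 - Real.log y)]

lemma negMulLog_le_add {x y : ℝ} (hx : 0 ≤ x) (hxy : x ≤ y) :
    Real.negMulLog y ≤ Real.negMulLog x + (y - x) * -Real.log y := by
  rcases hx.eq_or_lt with rfl | hx
  · simp [Real.negMulLog]
  have := mul_nonneg hx.le (sub_nonneg.2 (Real.log_le_log hx hxy))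
  simp only [Real.negMulLog]
  linarith

lemma negMulLog_le_add_sub {u v : ℝ} (hu : 0 ≤ u) (huv : u ≤ v) (hv : v ≤ 1) :
    Real.negMulLog u ≤ Real.negMulLog v + (v - u) := by
  rcases hu.eq_or_lt with rfl | hu
  · have := Real.negMulLog_nonneg huv hv
    simp; linarith
  have hv0 : 0 < v := hu.trans_le huv
  have h2 := Real.log_le_sub_one_of_pos (div_pos hv0 hu)
  rw [Real.log_div hv0.ne' hu.ne'] at h2
  have h3 : u * (Real.log v - Real.log u) ≤ v - u := by
    calc _ ≤ u * (v / u - 1) := by gcongr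
      _ = v - u := by field_simp
  have h4 : (v - u) * Real.log v ≤ 0 :=
    mul_nonpos_of_nonneg_of_nonpos (by linarith) (Real.log_nonpos hv0.le hv)
  simp only [Real.negMulLog]
  linarith

lemma binEntropy_le_add {x y : ℝ} (hx : 0 ≤ x) (hxy : x ≤ y) (hy : y ≤ 1) :
    Real.binEntropy y ≤ Real.binEntropy x + (y - x) * (1 - Real.log y) := by
  simp only [Real.binEntropy_eq_negMulLog_add_negMulLog_one_sub]
  have h1 := negMulLog_le_add hx hxy
  have h2 := negMulLog_le_add_sub (u := 1 - y) (v := 1 - x) (by linarith) (by linarith)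
    (by linarith)
  linarith

lemma two_mul_negMulLog_sqrt {y : ℝ} (hy : 0 ≤ y) :
    2 * Real.negMulLog √y = √y * -Real.log y := by
  rw [Real.negMulLog, Real.log_sqrt hy]; ring

/-- A modulus of continuity of the binary entropy, adapted to deviations of the size given by
Bernstein's inequality. -/
lemma binEntropy_le_of_le_add {x y a : ℝ} (hx : 0 ≤ x) (hxy : x ≤ y) (hy : y ≤ 1)
    (ha : 0 < a) (ha3 : a ≤ 1 / 3) (h : y ≤ x + 8 * a + 3 * √(x * a)) :
    Real.binEntropy y ≤
      Real.binEntropy x + 16 * Real.negMulLog a + 6 * Real.negMulLog √(x * a) := by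
  have hla := log_le_neg_one ha ha3
  have hx1 : x ≤ 1 := hxy.trans hy
  have hηa : 0 ≤ Real.negMulLog a := Real.negMulLog_nonneg ha.le (by linarith)
  have haη : a ≤ Real.negMulLog a := by
    simp only [Real.negMulLog]; nlinarith
  have hxa1 : √(x * a) ≤ 1 := by
    rw [Real.sqrt_le_one]; nlinarith
  have hηs : 0 ≤ Real.negMulLog √(x * a) := Real.negMulLog_nonneg (Real.sqrt_nonneg _) hxa1
  rcases le_total y a with hya | hya
  · have h1 := binEntropy_le_add le_rfl (hx.trans hxy) hy
    have h2 := negMulLog_mono (hx.trans hxy) hya ha3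
    have h3 := Real.binEntropy_nonneg hx hx1
    simp only [Real.binEntropy_zero, Real.negMulLog] at h1 h2 haη hηa ⊢
    simp only [Real.negMulLog] at hηs
    nlinarith
  · have hy0 : 0 < y := ha.trans_le hya
    have hly : 1 - Real.log y ≤ 2 * -Real.log a := by
      have := Real.log_le_log ha hya
      linarith
    have hly0 : 0 ≤ 1 - Real.log y := by
      have := Real.log_nonpos hy0.le hy
      linarith
    have h1 := binEntropy_le_add hx hxy hy
    have h2 : (y - x) * (1 - Real.log y) ≤ (8 * a + 3 * √(x * a)) * (1 - Real.log y) := by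
      gcongr; linarith
    have h3 : 8 * a * (1 - Real.log y) ≤ 16 * Real.negMulLog a := by
      calc _ ≤ 8 * a * (2 * -Real.log a) := by gcongr
        _ = _ := by rw [Real.negMulLog]; ring
    -- Here `-log y ≤ -log x` and `1 ≤ -log a`, so the factor is at most `-log (x * a)`.
    have h4 : √(x * a) * (1 - Real.log y) ≤ 2 * Real.negMulLog √(x * a) := by
      rw [two_mul_negMulLog_sqrt (by positivity)]
      rcases hx.eq_or_lt with rfl | hx
      · simp
      rw [Real.log_mul hx.ne' ha.ne']
      have := Real.log_le_log hx hxy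
      gcongr
      linarith
    linarith

/-! ### Optimism: the index dominates the true entropy. -/

/-- Matches the deviation with the modulus of continuity: `2√12 ≥ 6`, and `18 a log n` dominates `16
η(a)` because `1 / a ≤ n`. -/
lemma ucdBer_eq {q δ a : ℝ} {n : ℕ} (ha : a = Real.log (6 / δ) / n) (hn : 0 < n) (hqa : 0 ≤ q * a) :
    ucdBer q δ n = √12 * (2 * Real.negMulLog √(q * a)) + 18 * (a * Real.log n) := by
  have hn' : (0 : ℝ) < n := by exact_mod_cast hn
  have hL : Real.log (6 / δ) = a * n := by rw [ha]; field_simp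
  rw [ucdBer, hL, two_mul_negMulLog_sqrt hqa]
  have e1 : 12 * q * (a * n) / n = 12 * (q * a) := by field_simp
  have e2 : n / (q * (a * n)) = (q * a)⁻¹ := by
    rw [← mul_assoc, div_mul_cancel_right₀ hn'.ne']
  rw [e1, e2, Real.log_inv, Real.sqrt_mul (by norm_num)]
  field_simp

lemma sqrt_twelve_bounds : (3 : ℝ) ≤ √12 ∧ √12 ≤ 3.5 := by
  constructor
  · exact Real.le_sqrt_of_sq_le (by norm_num)
  · rw [Real.sqrt_le_left (by norm_num)]; norm_num

lemma two_sqrt_mul_le {p a : ℝ} (hp : 0 ≤ p) (ha : 0 ≤ a) : 2 * √(p * a) ≤ p + a := by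
  rw [Real.sqrt_mul hp]
  nlinarith [sq_nonneg (√p - √a), Real.sq_sqrt hp, Real.sq_sqrt ha]

/-- Interchange of the roles of the two parameters in a deviation bound. -/
lemma deviation_swap {x y z a : ℝ} (hx : 0 ≤ x) (ha : 0 ≤ a) (hxz : x ≤ z)
    (h : y ≤ x + 2 * √(z * a) + 2 * a) (hz : z ≤ y) : y ≤ x + 8 * a + 3 * √(x * a) := by
  have hzx : √(z * a) ≤ √(x * a) + √((z - x) * a) := by
    rw [Real.sqrt_le_left (by positivity)]
    have h1 := Real.sq_sqrt (mul_nonneg hx ha)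
    have h2 := Real.sq_sqrt (mul_nonneg (sub_nonneg.2 hxz) ha)
    nlinarith [mul_nonneg (Real.sqrt_nonneg (x * a)) (Real.sqrt_nonneg ((z - x) * a))]
  -- Weighted AM-GM: the part `(z - x) / 4 ≤ (y - x) / 4` is absorbed on the left, and dividing by
  -- `3 / 4` turns `6a` into `8a`.
  have h3 := two_sqrt_mul_le (p := (z - x) / 4) (a := 4 * a) (by linarith) (by linarith)
  rw [show (z - x) / 4 * (4 * a) = (z - x) * a by ring] at h3
  have := Real.sqrt_nonneg (x * a)
  linarith

lemma binEntropy_le_add_ucdBer {p q δ a : ℝ} {n : ℕ} (ha : a = Real.log (6 / δ) / n)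
    (hn : 3 ≤ n) (hL : 1 ≤ Real.log (6 / δ)) (hp0 : 0 ≤ p) (hp : p ≤ 1 / 2)
    (hq0 : 0 ≤ q) (hq : q ≤ 1) (hpq : p ≤ q + 2 * √(p * a) + 2 * a)
    (hqp : q ≤ p + 2 * √(p * a) + 2 * a) :
    Real.binEntropy p ≤ Real.binEntropy q + ucdBer q δ n := by
  have hn3 : (3 : ℝ) ≤ n := by exact_mod_cast hn
  have hn0 : (0 : ℝ) < n := by linarith
  have ha0 : 0 < a := by rw [ha]; positivity
  have hlogn := one_le_log_of_three_le hn3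
  have hqa0 : 0 ≤ q * a := by positivity
  have hhq := Real.binEntropy_nonneg hq0 hq
  have hhp : Real.binEntropy p ≤ Real.log 2 := Real.binEntropy_le_log_two
  have hlog2 : Real.log 2 < 0.7 := by have := Real.log_two_lt_d9; linarith
  obtain ⟨h12, h12'⟩ := sqrt_twelve_bounds
  rw [ucdBer_eq ha (by omega) hqa0]
  -- If `q * a > 1`, the first summand of the deviation is negative but at least `-7qa`, while the
  -- second is at least `18qa`; their sum exceeds `log 2`.
  rcases lt_or_ge 1 (q * a) with hqa | hqa
  · have h1 : √(q * a) * Real.log (q * a) ≤ 2 * (q * a) := by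
      have hs : 0 < √(q * a) := Real.sqrt_pos.2 (by linarith)
      have h2 := Real.log_le_sub_one_of_pos hs
      rw [Real.log_sqrt hqa0] at h2
      nlinarith [Real.sq_sqrt hqa0]
    rw [two_mul_negMulLog_sqrt hqa0]
    have h2 : q * a ≤ a * Real.log n := by nlinarith
    nlinarith
  have hs1 : √(q * a) ≤ 1 := Real.sqrt_le_one.2 hqa
  have hηs : 0 ≤ Real.negMulLog √(q * a) := Real.negMulLog_nonneg (Real.sqrt_nonneg _) hs1
  have hηs' : 0 ≤ √12 * (2 * Real.negMulLog √(q * a)) := by positivity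
  rcases le_or_gt (Real.log 2) (18 * (a * Real.log n)) with hal | hal
  · linarith
  have ha25 : a ≤ 1 / 25 := by nlinarith
  have hηa : Real.negMulLog a ≤ a * Real.log n := by
    rw [Real.negMulLog, neg_mul, ← mul_neg, ← Real.log_inv]
    gcongr
    rw [ha, inv_div]
    exact div_le_self hn0.le hL
  have hηa0 : 0 ≤ Real.negMulLog a := Real.negMulLog_nonneg ha0.le (by linarith)
  have hsmall : √(q * a) ≤ 1 / 3 := by
    rw [Real.sqrt_le_left (by norm_num)]; nlinarith
  have key : ∀ x, 0 ≤ x → x ≤ p → x ≤ q → p ≤ x + 2 * √(p * a) + 2 * a →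
      Real.binEntropy p ≤ Real.binEntropy x +
        (√12 * (2 * Real.negMulLog √(q * a)) + 18 * (a * Real.log n)) := by
    intro x hx0 hxp hxq h
    have h1 := binEntropy_le_of_le_add hx0 hxp (by linarith) ha0 (by linarith)
      (deviation_swap hx0 ha0.le hxp h le_rfl)
    have h2 : Real.negMulLog √(x * a) ≤ Real.negMulLog √(q * a) :=
      negMulLog_mono (Real.sqrt_nonneg _) (by gcongr) hsmall
    nlinarith
  rcases le_total q p with h | h
  · exact key q hq0 h le_rfl hpq
  -- Between `p` and `1 - p` the entropy is at least its value at `p`. Beyond `1 - p`, the symmetry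
  -- of the entropy reduces to the estimate `1 - q ≤ p`.
  rcases le_total q (1 - p) with h' | h'
  · have : Real.binEntropy p ≤ Real.binEntropy q := by
      rcases le_total q 2⁻¹ with h2 | h2
      · exact Real.binEntropy_strictMonoOn.monotoneOn ⟨hp0, h.trans h2⟩ ⟨hq0, h2⟩ h
      · rw [← Real.binEntropy_one_sub p]
        exact Real.binEntropy_strictAntiOn.antitoneOn ⟨h2, hq⟩
          ⟨h2.trans h', by linarith⟩ h'
    have : 0 ≤ a * Real.log n := by positivity
    linarith
  · have := key (1 - q) (by linarith) (by linarith) (by linarith) (by linarith)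
    rwa [Real.binEntropy_one_sub] at this

/-! ### Upper bound on the index of a well-sampled arm. -/

lemma log_div_self_le {x N : ℝ} (hN : 3 ≤ N) (h : N ≤ x) : Real.log x / x ≤ Real.log N / N :=
  Real.log_div_self_antitoneOn (exp_one_le_three.trans hN)
    (exp_one_le_three.trans (hN.trans h)) h

/-- Since `log x / x` decreases beyond `e`, only the threshold matters. There the logarithm is at
most `2 log s`, as `6 log s ≤ s` for `s ≥ 150`. -/
lemma log_le_of_threshold_lt {s x : ℝ} (hs : 150 ≤ s) (h : 6 * (s * Real.log s) < x) :
    Real.log x ≤ x / (3 * s) := by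
  have hs0 : 0 < s := by linarith
  have hl1 := one_le_log_of_three_le (by linarith : 3 ≤ s)
  have hN : 3 ≤ 6 * (s * Real.log s) := by nlinarith
  have hx : 0 < x := by linarith
  have h1 := log_div_self_le hN h.le
  have h2 : Real.log (6 * (s * Real.log s)) ≤ 2 * Real.log s := by
    rw [show 2 * Real.log s = Real.log (s * s) by
      rw [Real.log_mul hs0.ne' hs0.ne']; ring]
    apply Real.log_le_log (by linarith)
    have h3 := Real.log_le_sub_one_of_pos (Real.sqrt_pos.2 hs0)
    rw [Real.log_sqrt hs0.le] at h3
    have h4 : 12 ≤ √s := Real.le_sqrt_of_sq_le (by linarith)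
    have h5 := Real.sq_sqrt hs0.le
    have h6 : 6 * Real.log s ≤ s := by nlinarith
    nlinarith
  have h3 : Real.log (6 * (s * Real.log s)) / (6 * (s * Real.log s)) ≤ 1 / (3 * s) := by
    rw [div_le_div_iff₀ (by linarith) (by positivity)]
    nlinarith
  have h4 := h1.trans h3
  rw [div_le_iff₀ hx] at h4
  calc _ ≤ _ := h4
    _ = _ := by ring

lemma negMulLog_sqrt_add_le {y z : ℝ} (hy : 0 ≤ y) (hz : 0 ≤ z) (h : y + z ≤ 1) :
    Real.negMulLog √(y + z) ≤ Real.negMulLog √y + Real.negMulLog √z := by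
  have hs : √(y + z) ≤ √y + √z := sqrt_add_le_sqrt_add hy hz
  have h0 : ∀ {u v : ℝ}, 0 ≤ u → u ≤ v → u * -Real.log v ≤ u * -Real.log u := by
    intro u v hu huv
    rcases hu.eq_or_lt with rfl | hu
    · simp
    · gcongr
  have h1 := h0 (Real.sqrt_nonneg y) (Real.sqrt_le_sqrt (by linarith : y ≤ y + z))
  have h2 := h0 (Real.sqrt_nonneg z) (Real.sqrt_le_sqrt (by linarith : z ≤ y + z))
  have h3 : √(y + z) * -Real.log √(y + z) ≤ (√y + √z) * -Real.log √(y + z) := by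
    gcongr
    have := Real.log_nonpos (Real.sqrt_nonneg (y + z)) (Real.sqrt_le_one.2 h)
    linarith
  simp only [Real.negMulLog]
  linarith

/-- An approximate inverse of `η`: `-log (u / (7l)) = l / 2 + log (7l)`, which is at most `7l / 4`
once `l ≥ 4`. -/
lemma negMulLog_div_le {u : ℝ} (hu0 : 0 < u) (hu : u ≤ 0.105) {l : ℝ}
    (hl : l = -2 * Real.log u) : Real.negMulLog (u / (7 * l)) ≤ u / 4 := by
  have hl4 : 4 ≤ l := by
    have h1 : Real.log u ≤ Real.log (1 / 9) + (u * 9 - 1) := by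
      have := Real.log_le_sub_one_of_pos (x := u * 9) (by positivity)
      rw [Real.log_mul hu0.ne' (by norm_num)] at this
      rw [one_div, Real.log_inv]; linarith
    have h2 : Real.log (1 / 9) ≤ -2 := by
      rw [one_div, Real.log_inv, show (9 : ℝ) = 3 ^ 2 by norm_num, Real.log_pow]
      have := one_le_log_of_three_le (le_refl (3 : ℝ))
      push_cast; linarith
    by_contra hc
    have h3 : Real.log u ≤ Real.log 0.105 := Real.log_le_log hu0 hu
    have h4 : Real.log 0.105 ≤ -2 := by
      rw [← Real.log_exp (-2)]
      apply Real.log_le_log (by norm_num)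
      rw [Real.exp_neg, le_inv_comm₀ (by norm_num) (Real.exp_pos _),
        show (2 : ℝ) = 1 + 1 by norm_num, Real.exp_add]
      have := exp_one_le_three
      have := Real.exp_pos 1
      nlinarith
    linarith
  have hl0 : 0 < l := by linarith
  have h7 : Real.log (7 * l) ≤ l + 1 := by
    have h1 := Real.log_le_sub_one_of_pos hl0
    have h2 : Real.log 7 ≤ 2 := by
      rw [Real.log_le_iff_le_exp (by norm_num), show (2 : ℝ) = 1 + 1 by norm_num, Real.exp_add]
      have := Real.exp_one_gt_d9
      nlinarith
    rw [Real.log_mul (by norm_num) hl0.ne']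
    linarith
  rw [Real.negMulLog, Real.log_div hu0.ne' (by positivity)]
  have : -(u / (7 * l)) * (Real.log u - Real.log (7 * l)) ≤ u / (7 * l) * (7 / 4 * l) := by
    rw [neg_mul, ← mul_neg]
    gcongr
    linarith
  calc _ ≤ _ := this
    _ = _ := by field_simp

lemma negMulLog_sqrt_le_of_mul_le {β Δ x y : ℝ} (hβ0 : 0 < β) (hβ : β ≤ 1) (hΔ0 : 0 < Δ)
    (hΔ : Δ ≤ 0.7) (h : 5120 * x * Real.log (48 / (β ^ 2 * Δ ^ 2)) ^ 2 ≤ β ^ 2 * Δ ^ 2)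
    (hy : 0 ≤ y) (hyx : y ≤ 2 * x) : Real.negMulLog √y ≤ β * Δ / 27 := by
  -- Chosen so that `log (48 / (β²Δ²)) = -2 log u`. The hypothesis gives `y ≤ 96u² / (5120 l²) ≤ (u
  -- / (7l))²`, and `4√48 > 27` yields the final constant.
  set u := β * Δ / √48 with hu
  have h48 : √48 ^ 2 = 48 := Real.sq_sqrt (by norm_num)
  have h48' : 6.9 ≤ √48 := Real.le_sqrt_of_sq_le (by norm_num)
  have hu0 : 0 < u := by positivity
  have huβ : u * 6.9 ≤ β * Δ := by
    calc u * 6.9 ≤ u * √48 := by gcongr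
      _ = β * Δ := by rw [hu]; field_simp
  have hu1 : u ≤ 0.105 := by
    have : β * Δ ≤ 0.7 := by nlinarith
    linarith
  have hu2 : u ^ 2 = β ^ 2 * Δ ^ 2 / 48 := by rw [hu, div_pow, h48]; ring
  set l := -2 * Real.log u with hl
  have hl' : Real.log (48 / (β ^ 2 * Δ ^ 2)) = l := by
    rw [hl, show 48 / (β ^ 2 * Δ ^ 2) = (u ^ 2)⁻¹ by rw [hu2]; field_simp, Real.log_inv,
      Real.log_pow]
    push_cast; ring
  have hl1 : 2 ≤ l := by
    have := log_le_neg_one hu0 (by linarith)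
    linarith
  have hx1 : √y ≤ u / (7 * l) := by
    rw [Real.sqrt_le_left (by positivity), div_pow, hu2, le_div_iff₀ (by positivity)]
    rw [hl'] at h
    have h4 : y * l ^ 2 ≤ 2 * x * l ^ 2 := by gcongr
    have h5 : 0 ≤ y * l ^ 2 := by positivity
    linarith
  have hx1u : u / (7 * l) ≤ 1 / 3 := by
    rw [div_le_iff₀ (by positivity)]; linarith
  have := (negMulLog_mono (Real.sqrt_nonneg _) hx1 hx1u).trans (negMulLog_div_le hu0 hu1 hl)
  linarith

lemma negMulLog_sqrt_three_mul_sq_le {a : ℝ} (ha0 : 0 < a) (ha : a ≤ 1 / 100) :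
    Real.negMulLog √(3 * a ^ 2) ≤ 2 * Real.negMulLog a := by
  have h3' : (1 : ℝ) ≤ √3 ∧ √3 ≤ 2 :=
    ⟨Real.le_sqrt_of_sq_le (by norm_num), by rw [Real.sqrt_le_left (by norm_num)]; norm_num⟩
  rw [Real.sqrt_mul (by norm_num), Real.sqrt_sq ha0.le]
  calc _ ≤ Real.negMulLog (2 * a) := negMulLog_mono (by positivity) (by gcongr; exact h3'.2)
          (by linarith)
    _ ≤ 2 * Real.negMulLog a := by
      rw [Real.negMulLog_mul]
      have : Real.negMulLog 2 ≤ 0 := by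
        have := Real.log_nonneg (by norm_num : (1 : ℝ) ≤ 2)
        simp only [Real.negMulLog]; linarith
      nlinarith

lemma mul_log_le_of_polylogLin_lt {b L x : ℝ} (hb0 : 0 < b) (hb : b ≤ 0.7) (hL : 3 ≤ L)
    (hx : 0 < x) (h : 6 * polylogLin 1 (36 * L / b) < x) : L / x * Real.log x ≤ b / 108 := by
  have hs150 : 150 ≤ 36 * L / b := by
    rw [le_div_iff₀ hb0]; linarith
  have h1 := log_le_of_threshold_lt hs150 (x := x) (by simpa [polylogLin] using h)
  calc L / x * Real.log x ≤ L / x * (x / (3 * (36 * L / b))) := by gcongr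
    _ = b / 108 := by field_simp; ring

lemma negMulLog_sqrt_mul_le {p q a : ℝ} (hp0 : 0 ≤ p) (hp : p ≤ 1 / 2) (ha0 : 0 < a)
    (ha : a ≤ 1 / 100) (hqp : q ≤ p + 2 * √(p * a) + 2 * a) :
    Real.negMulLog √(q * a) ≤ Real.negMulLog √(2 * (p * a)) + 2 * Real.negMulLog a := by
  have hqa : q * a ≤ 2 * (p * a) + 3 * a ^ 2 := by
    have h1 : q ≤ 2 * p + 3 * a := by
      have := two_sqrt_mul_le hp0 ha0.le
      linarith
    calc q * a ≤ (2 * p + 3 * a) * a := by gcongr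
      _ = _ := by ring
  have hpa : p * a ≤ 1 / 2 * (1 / 100) := by gcongr
  have ha2 : a ^ 2 ≤ (1 / 100) ^ 2 := by gcongr
  have h2 := negMulLog_sqrt_add_le (y := 2 * (p * a)) (z := 3 * a ^ 2) (by positivity)
    (by positivity) (by linarith)
  have h3 : Real.negMulLog √(q * a) ≤ Real.negMulLog √(2 * (p * a) + 3 * a ^ 2) :=
    negMulLog_mono (Real.sqrt_nonneg _) (Real.sqrt_le_sqrt hqa)
      (by rw [Real.sqrt_le_left (by norm_num)]; linarith)
  have h4 := negMulLog_sqrt_three_mul_sq_le ha0 ha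
  linarith

/-- The entropy increment costs `16A + 6U` and the deviation at most `7(U + 2A) + 18A`. -/
lemma binEntropy_add_ucdBer_le {p q δ a A U : ℝ} {n : ℕ} (ha : a = Real.log (6 / δ) / n)
    (hn : 3 ≤ n) (hL : 1 ≤ Real.log (6 / δ)) (hp0 : 0 ≤ p) (hp : p ≤ 1 / 2)
    (hq0 : 0 ≤ q) (hq : q ≤ 1) (hqp : q ≤ p + 2 * √(p * a) + 2 * a)
    (hA : a * Real.log n ≤ A) (hA1 : A ≤ 1 / 100)
    (hU1 : Real.negMulLog √(p * a) ≤ U) (hU2 : Real.negMulLog √(2 * (p * a)) ≤ U) :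
    Real.binEntropy q + ucdBer q δ n ≤ Real.binEntropy p + 48 * A + 13 * U := by
  have hn3 : (3 : ℝ) ≤ n := by exact_mod_cast hn
  have hn0 : (0 : ℝ) < n := by linarith
  have ha0 : 0 < a := by rw [ha]; positivity
  have hlogn := one_le_log_of_three_le hn3
  have ha100 : a ≤ 1 / 100 := (le_mul_of_one_le_right ha0.le hlogn).trans (hA.trans hA1)
  have hA0 : 0 ≤ A := le_trans (by positivity) hA
  have hηa : Real.negMulLog a ≤ A := by
    refine le_trans ?_ hA
    rw [Real.negMulLog, neg_mul, ← mul_neg, ← Real.log_inv]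
    gcongr
    rw [ha, inv_div]
    exact div_le_self hn0.le hL
  have hpa : p * a ≤ 1 / 2 * (1 / 100) := by gcongr
  have hU0 : 0 ≤ U := (Real.negMulLog_nonneg (Real.sqrt_nonneg _)
    (Real.sqrt_le_one.2 (by linarith))).trans hU1
  have hηq := negMulLog_sqrt_mul_le hp0 hp ha0 ha100 hqp
  have hh : Real.binEntropy q ≤ Real.binEntropy p + 16 * A + 6 * U := by
    rcases le_total q p with h | h
    · have := Real.binEntropy_strictMonoOn.monotoneOn (a := q) (b := p)
        ⟨hq0, by linarith⟩ ⟨hp0, by linarith⟩ h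
      linarith
    · have hsn := Real.sqrt_nonneg (p * a)
      have := binEntropy_le_of_le_add hp0 h hq ha0 (by linarith) (by linarith)
      linarith
  obtain ⟨h12, h12'⟩ := sqrt_twelve_bounds
  rw [ucdBer_eq ha (by omega) (by positivity)]
  have hucd : √12 * (2 * Real.negMulLog √(q * a)) ≤ 3.5 * (2 * (U + 2 * A)) := by
    have : 2 * Real.negMulLog √(q * a) ≤ 2 * (U + 2 * A) := by linarith
    calc _ ≤ √12 * (2 * (U + 2 * A)) := by gcongr
      _ ≤ _ := by gcongr
  linarith

/-- The parameter `β` splits the gap. The linear threshold gives `A = (1 - β)Δ / 108` and the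
quadratic one `U = βΔ / 27`; then `48A + 13U < Δ`, as `48 / 108` and `13 / 27` are below `1`. -/
lemma binEntropy_add_ucdBer_lt {p q δ a β Δ L : ℝ} {n : ℕ} (ha : a = Real.log (6 / δ) / n)
    (hn : 3 ≤ n) (h3 : 3 ≤ Real.log (6 / δ)) (hL : Real.log (6 / δ) ≤ L)
    (hp0 : 0 ≤ p) (hp : p ≤ 1 / 2) (hq0 : 0 ≤ q) (hq : q ≤ 1)
    (hqp : q ≤ p + 2 * √(p * a) + 2 * a) (hβ0 : 0 < β) (hβ : β < 1)
    (hΔ0 : 0 < Δ) (hΔ : Δ ≤ Real.log 2)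
    (hlin : 6 * polylogLin 1 (36 * L / ((1 - β) * Δ)) < n)
    (hquad : 5120 * p * L / (β ^ 2 * Δ ^ 2) * Real.log (48 / (β ^ 2 * Δ ^ 2)) ^ 2 < n) :
    Real.binEntropy q + ucdBer q δ n < Real.binEntropy p + Δ := by
  have hn0 : (0 : ℝ) < n := by exact_mod_cast (by omega : 0 < n)
  have ha0 : 0 < a := by rw [ha]; positivity
  have hΔ7 : Δ ≤ 0.7 := by have := Real.log_two_lt_d9; linarith
  have hβΔ : 0 < β * Δ := by positivity
  have hb : 0 < (1 - β) * Δ := mul_pos (by linarith) hΔ0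
  have haL : a ≤ L / n := by rw [ha]; gcongr
  have hA : a * Real.log n ≤ (1 - β) * Δ / 108 :=
    (mul_le_mul_of_nonneg_right haL (Real.log_natCast_nonneg n)).trans
      (mul_log_le_of_polylogLin_lt hb (by linarith) (by linarith) hn0 hlin)
  have hquad' : 5120 * (p * a) * Real.log (48 / (β ^ 2 * Δ ^ 2)) ^ 2 ≤ β ^ 2 * Δ ^ 2 := by
    have h1 : 5120 * p * L * Real.log (48 / (β ^ 2 * Δ ^ 2)) ^ 2 ≤ n * (β ^ 2 * Δ ^ 2) := by
      have := hquad.le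
      rw [div_mul_eq_mul_div, div_le_iff₀ (by positivity)] at this
      exact this
    calc _ ≤ 5120 * (p * (L / n)) * Real.log (48 / (β ^ 2 * Δ ^ 2)) ^ 2 := by gcongr
      _ = 5120 * p * L * Real.log (48 / (β ^ 2 * Δ ^ 2)) ^ 2 / n := by ring
      _ ≤ _ := by rw [div_le_iff₀ hn0]; linarith
  have hpa0 : 0 ≤ p * a := by positivity
  have hη := negMulLog_sqrt_le_of_mul_le hβ0 hβ.le hΔ0 hΔ7 hquad'
    (y := 2 * (p * a)) (by positivity) le_rfl
  have hη' := negMulLog_sqrt_le_of_mul_le hβ0 hβ.le hΔ0 hΔ7 hquad' hpa0 (by linarith)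
  have := binEntropy_add_ucdBer_le ha hn (by linarith) hp0 hp hq0 hq hqp hA (by linarith) hη' hη
  linarith

/-! ### Counting processes and their adaptedness. -/

lemma playCount_zero {Ω : Type*} {K : ℕ} (I : ℕ → Ω → Fin K) (i : Fin K) (ω : Ω) :
    playCount I i 0 ω = 0 := by
  simp [playCount]

lemma playCount_succ {Ω : Type*} {K : ℕ} (I : ℕ → Ω → Fin K) (i : Fin K) (t : ℕ) (ω : Ω) :
    playCount I i (t + 1) ω = playCount I i t ω + if I (t + 1) ω = i then 1 else 0 := by
  unfold playCount
  rw [← Finset.insert_Icc_right_eq_Icc_add_one (by omega), Finset.filter_insert]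
  split_ifs with h
  · rw [Finset.card_insert_of_notMem (by simp)]
  · simp

lemma playCount_le {Ω : Type*} {K : ℕ} (I : ℕ → Ω → Fin K) (i : Fin K) (t : ℕ) (ω : Ω) :
    playCount I i t ω ≤ t := by
  unfold playCount
  exact (Finset.card_filter_le _ _).trans (by simp)

lemma sum_playCount {Ω : Type*} {K : ℕ} (I : ℕ → Ω → Fin K) (t : ℕ) (ω : Ω) :
    ∑ i, playCount I i t ω = t := by
  induction t with
  | zero => simp [playCount_zero]
  | succ t ih => simp [playCount_succ, Finset.sum_add_distrib, ih]

/-- The number of symbols `1` among those observed from arm `i`. -/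
def onesCount {Ω : Type*} {K : ℕ} (X : Fin K → ℕ → Ω → Bool) (I : ℕ → Ω → Fin K)
    (i : Fin K) (t : ℕ) (ω : Ω) : ℕ := (observed X I i t ω).count true

lemma onesCount_succ {Ω : Type*} {K : ℕ} (X : Fin K → ℕ → Ω → Bool) (I : ℕ → Ω → Fin K)
    (i : Fin K) (t : ℕ) (ω : Ω) : onesCount X I i (t + 1) ω =
      onesCount X I i t ω + if I (t + 1) ω = i ∧ X i (t + 1) ω = true then 1 else 0 := by
  unfold onesCount
  rw [observed]
  by_cases h : I (t + 1) ω = i <;> cases hX : X i (t + 1) ω <;> simp [h]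

lemma onesCount_le_playCount {Ω : Type*} {K : ℕ} (X : Fin K → ℕ → Ω → Bool)
    (I : ℕ → Ω → Fin K) (i : Fin K) (t : ℕ) (ω : Ω) :
    onesCount X I i t ω ≤ playCount I i t ω := by
  induction t with
  | zero => simp [onesCount, observed]
  | succ t ih =>
    rw [onesCount_succ, playCount_succ]
    split_ifs <;> simp_all; omega

section

variable {Ω : Type*} {mΩ : MeasurableSpace Ω} {P : Measure Ω} {ℱ : Filtration ℕ mΩ} {K : ℕ}
  {p : Fin K → ℝ} {X : Fin K → ℕ → Ω → Bool} {I : ℕ → Ω → Fin K}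

lemma measurable_playCount (hI : ∀ t, Measurable[ℱ t] (I (t + 1))) (i : Fin K) (t : ℕ) :
    Measurable[ℱ t] (playCount I i t) := by
  induction t with
  | zero =>
    have : playCount I i 0 = fun _ => 0 := funext fun ω => playCount_zero I i ω
    rw [this]; exact measurable_const
  | succ t ih =>
    have : playCount I i (t + 1) =
        fun ω => playCount I i t ω + (fun k : Fin K => if k = i then 1 else 0) (I (t + 1) ω) :=
      funext fun ω => playCount_succ I i t ω
    rw [this]
    exact (ih.mono (ℱ.mono (Nat.le_succ t)) le_rfl).add
      ((measurable_of_finite (fun k : Fin K => if k = i then 1 else 0)).comp ((hI t).mono (ℱ.mono (Nat.le_succ t)) le_rfl))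

lemma measurable_onesCount (hX : ∀ i t, 1 ≤ t → Measurable[ℱ t] (X i t))
    (hI : ∀ t, Measurable[ℱ t] (I (t + 1))) (i : Fin K) (t : ℕ) :
    Measurable[ℱ t] (onesCount X I i t) := by
  induction t with
  | zero =>
    have : onesCount X I i 0 = fun _ => 0 := funext fun ω => by simp [onesCount, observed]
    rw [this]; exact measurable_const
  | succ t ih =>
    have : onesCount X I i (t + 1) = fun ω => onesCount X I i t ω +
        (fun k : Fin K × Bool => if k.1 = i ∧ k.2 = true then 1 else 0)
          (I (t + 1) ω, X i (t + 1) ω) :=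
      funext fun ω => onesCount_succ X I i t ω
    rw [this]
    exact (ih.mono (ℱ.mono (Nat.le_succ t)) le_rfl).add
      ((measurable_of_finite
        (fun k : Fin K × Bool => if k.1 = i ∧ k.2 = true then 1 else 0)).comp
        (((hI t).mono (ℱ.mono (Nat.le_succ t)) le_rfl).prodMk (hX i (t + 1) (by omega))))

/-! ### Concentration at a random sample size. -/

/-- The exponential moment of a Bernoulli variable, in Poisson form. -/
lemma lintegral_exp_bool_le [IsProbabilityMeasure P] {Y : Ω → Bool} (hY : Measurable Y) {r : ℝ}
    (hr : P.real {ω | Y ω = true} = r) (l : ℝ) :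
    ∫⁻ ω, ENNReal.ofReal (Real.exp ((if Y ω = true then l else 0) - r * (Real.exp l - 1))) ∂P
      ≤ 1 := by
  set c := r * (Real.exp l - 1) with hc
  have hms : MeasurableSet {ω | Y ω = true} := hY (measurableSet_singleton true)
  have h1 : (fun ω => Real.exp ((if Y ω = true then l else 0) - c)) =
      fun ω => Real.exp (-c) + {ω | Y ω = true}.indicator
        (fun _ => Real.exp (l - c) - Real.exp (-c)) ω := by
    funext ω
    by_cases h : Y ω = true <;> simp [h]
  have hint : Integrable (fun ω => Real.exp ((if Y ω = true then l else 0) - c)) P := by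
    rw [h1]
    exact (integrable_const _).add ((integrable_const _).indicator hms)
  rw [← ofReal_integral_eq_lintegral_ofReal hint (ae_of_all _ fun _ => (Real.exp_pos _).le),
    ENNReal.ofReal_le_one, h1,
    integral_add (integrable_const _) ((integrable_const _).indicator hms),
    integral_indicator_const _ hms, hr]
  simp only [integral_const, probReal_univ, smul_eq_mul, one_mul]
  have h2 : Real.exp (l - c) = Real.exp (-c) * Real.exp l := by rw [← Real.exp_add]; ring_nf
  have h3 : 1 + c ≤ Real.exp c := by have := Real.add_one_le_exp c; linarith
  calc _ = Real.exp (-c) * (1 + c) := by rw [h2, hc]; ring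
    _ ≤ Real.exp (-c) * Real.exp c := by gcongr
    _ = 1 := by rw [← Real.exp_add]; simp

/-- The exponential supermartingale of the symbols observed from arm `i`. -/
lemma lintegral_exp_onesCount_le [IsProbabilityMeasure P] (hX : IsBernoulliSources P ℱ p X)
    (hI : ∀ t, Measurable[ℱ t] (I (t + 1))) (i : Fin K) (l : ℝ) (t : ℕ) :
    ∫⁻ ω, ENNReal.ofReal (Real.exp (l * onesCount X I i t ω
      - playCount I i t ω * (p i * (Real.exp l - 1)))) ∂P ≤ 1 := by
  set c := p i * (Real.exp l - 1) with hc
  induction t with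
  | zero => simp [onesCount, observed, playCount_zero]
  | succ t ih =>
    set M : Ω → ENNReal := fun ω => ENNReal.ofReal (Real.exp (l * onesCount X I i t ω
      - playCount I i t ω * c)) with hM
    have hN := measurable_playCount hI i t
    have hS := measurable_onesCount hX.adapted hI i t
    have hMm : Measurable[ℱ t] M := by
      have : M = (fun k : ℕ × ℕ => ENNReal.ofReal (Real.exp (l * k.1 - k.2 * c))) ∘
        fun ω => (onesCount X I i t ω, playCount I i t ω) := rfl
      rw [this]
      exact (measurable_of_countable _).comp (hS.prodMk hN)
    have hA : MeasurableSet[ℱ t] {ω | I (t + 1) ω = i} := hI t (measurableSet_singleton i)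
    set g : Ω → ENNReal := fun ω =>
      ENNReal.ofReal (Real.exp ((if X i (t + 1) ω = true then l else 0) - c)) with hg
    have hgm : Measurable[MeasurableSpace.comap (X i (t + 1)) inferInstance] g := by
      have : g = (fun b : Bool => ENNReal.ofReal (Real.exp ((if b = true then l else 0) - c))) ∘
        X i (t + 1) := rfl
      rw [this]
      exact (measurable_of_finite _).comp (comap_measurable _)
    have hXm : Measurable (X i (t + 1)) :=
      (hX.adapted i (t + 1) (by omega)).mono (ℱ.le _) le_rfl
    -- The process changes only if arm `i` is played, and then by the factor `g`, independent of the
    -- past.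
    have hsplit : ∀ ω, ENNReal.ofReal (Real.exp (l * onesCount X I i (t + 1) ω
        - playCount I i (t + 1) ω * c)) =
        {ω | I (t + 1) ω = i}ᶜ.indicator M ω + {ω | I (t + 1) ω = i}.indicator M ω * g ω := by
      intro ω
      rw [onesCount_succ, playCount_succ]
      by_cases h : I (t + 1) ω = i
      · simp only [h, true_and, if_true, Set.indicator, Set.mem_compl_iff, Set.mem_ofPred_eq,
          not_true_eq_false, if_false, zero_add, hM, hg]
        rw [← ENNReal.ofReal_mul (Real.exp_pos _).le, ← Real.exp_add]
        congr 2
        split_ifs <;> push_cast <;> ring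
      · simp [h, hM]
    have hindep := lintegral_mul_eq_lintegral_mul_lintegral_of_independent_measurableSpace
      (ℱ.le t) hXm.comap_le (hX.memoryless i t).symm (hMm.indicator hA) hgm
    calc _ = ∫⁻ ω, ({ω | I (t + 1) ω = i}ᶜ.indicator M ω
          + {ω | I (t + 1) ω = i}.indicator M ω * g ω) ∂P := lintegral_congr hsplit
      _ = ∫⁻ ω, {ω | I (t + 1) ω = i}ᶜ.indicator M ω ∂P
          + (∫⁻ ω, {ω | I (t + 1) ω = i}.indicator M ω ∂P) * ∫⁻ ω, g ω ∂P := by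
        rw [lintegral_add_left ((hMm.indicator hA.compl).mono (ℱ.le t) le_rfl), hindep]
      _ ≤ ∫⁻ ω, {ω | I (t + 1) ω = i}ᶜ.indicator M ω ∂P
          + (∫⁻ ω, {ω | I (t + 1) ω = i}.indicator M ω ∂P) * 1 := by
        gcongr
        exact lintegral_exp_bool_le hXm (hX.law i (t + 1) (by omega)) l
      _ = ∫⁻ ω, M ω ∂P := by
        rw [mul_one, ← lintegral_add_left ((hMm.indicator hA.compl).mono (ℱ.le t) le_rfl)]
        refine lintegral_congr fun ω => ?_
        exact Set.indicator_compl_add_self_apply _ M ω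
      _ ≤ 1 := ih

/-- Markov's inequality for the supermartingale. Multiplying by `l` of either sign covers both
tails. -/
lemma measure_chernoff_le [IsProbabilityMeasure P] (hX : IsBernoulliSources P ℱ p X)
    (hI : ∀ t, Measurable[ℱ t] (I (t + 1))) (i : Fin K) (l x : ℝ) (t n : ℕ) :
    P.real {ω | playCount I i t ω = n ∧ l * x ≤ l * onesCount X I i t ω} ≤
      Real.exp (n * (p i * (Real.exp l - 1)) - l * x) := by
  set c := p i * (Real.exp l - 1) with hc
  have hm : Measurable fun ω => ENNReal.ofReal (Real.exp (l * onesCount X I i t ω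
      - playCount I i t ω * c)) := by
    have : (fun ω => ENNReal.ofReal (Real.exp (l * onesCount X I i t ω
        - playCount I i t ω * c))) =
      (fun k : ℕ × ℕ => ENNReal.ofReal (Real.exp (l * k.1 - k.2 * c))) ∘
        fun ω => (onesCount X I i t ω, playCount I i t ω) := rfl
    rw [this]
    exact (measurable_of_countable _).comp
      (((measurable_onesCount hX.adapted hI i t).mono (ℱ.le t) le_rfl).prodMk
        ((measurable_playCount hI i t).mono (ℱ.le t) le_rfl))
  have h1 := (mul_meas_ge_le_lintegral hm (μ := P) (ENNReal.ofReal (Real.exp (l * x - n * c)))).trans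
    (lintegral_exp_onesCount_le hX hI i l t)
  set E := {ω | playCount I i t ω = n ∧ l * x ≤ l * onesCount X I i t ω}
  have h2 : ENNReal.ofReal (Real.exp (l * x - n * c)) * P E ≤ 1 := by
    refine le_trans ?_ h1
    gcongr
    rintro ω ⟨hn, hx⟩
    simp only [Set.mem_ofPred_eq, hn]
    gcongr
  have h3 : Real.exp (l * x - n * c) * P.real E ≤ 1 := by
    have := ENNReal.toReal_mono ENNReal.one_ne_top h2
    rwa [ENNReal.toReal_mul, ENNReal.toReal_ofReal (Real.exp_pos _).le, ENNReal.toReal_one] at this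
  have h4 : Real.exp (n * c - l * x) * (Real.exp (l * x - n * c) * P.real E) = P.real E := by
    rw [← mul_assoc, ← Real.exp_add]; simp
  rw [← h4]
  exact mul_le_of_le_one_right (Real.exp_pos _).le h3

/-- The empirical probability of arm `i` after round `t` is computed from `n` symbols and deviates
from its mean by more than Bernstein's inequality at level `L` allows. -/
def deviationSet (p : Fin K → ℝ) (X : Fin K → ℕ → Ω → Bool) (I : ℕ → Ω → Fin K) (L : ℝ)
    (i : Fin K) (t n : ℕ) : Set Ω :=
  {ω | playCount I i t ω = n ∧
    2 * √(p i * (L / n)) + 2 * (L / n) < |(onesCount X I i t ω : ℝ) / n - p i|}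

lemma measurableSet_deviationSet (hX : IsBernoulliSources P ℱ p X)
    (hI : ∀ t, Measurable[ℱ t] (I (t + 1))) (L : ℝ) (i : Fin K) (t n : ℕ) :
    MeasurableSet (deviationSet p X I L i t n) := by
  have h1 := (measurable_onesCount hX.adapted hI i t).mono (ℱ.le t) le_rfl
  have h2 := (measurable_playCount hI i t).mono (ℱ.le t) le_rfl
  exact (h1.prodMk h2) (MeasurableSet.of_discrete (s := {k : ℕ × ℕ | k.2 = n ∧
    2 * √(p i * (L / n)) + 2 * (L / n) < |(k.1 : ℝ) / n - p i|}))

lemma exp_le_one_add_add_sq {x : ℝ} (hx : |x| ≤ 1) : Real.exp x - 1 ≤ x + x ^ 2 := by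
  have := (abs_le.1 (Real.abs_exp_sub_one_sub_id_le hx)).2
  linarith

lemma measure_deviationSet_le [IsProbabilityMeasure P] (hX : IsBernoulliSources P ℱ p X)
    (hI : ∀ t, Measurable[ℱ t] (I (t + 1))) {L : ℝ} (hL : 0 < L) (i : Fin K) (hp : 0 ≤ p i)
    (t n : ℕ) (hn : 0 < n) :
    P.real (deviationSet p X I L i t n) ≤ 2 * Real.exp (-L) := by
  have hn0 : (0 : ℝ) < n := by exact_mod_cast hn
  set a := L / n with ha
  have ha0 : 0 < a := by positivity
  have hna : n * a = L := by rw [ha]; field_simp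
  -- If `a ≤ p`, the optimal tilt `±√(a / p)` is at most `1` in size, where `exp x - 1 ≤ x + x²`
  -- applies. Otherwise the lower tail is empty, since `p - 2a < 0`, and the tilt `1` suffices.
  rcases le_or_gt a (p i) with hap | hap
  · have hp0 : 0 < p i := ha0.trans_le hap
    set l := √(a / p i) with hl
    have hl0 : 0 < l := by positivity
    have hl1 : l ≤ 1 := by
      rw [hl, Real.sqrt_le_left (by norm_num), one_pow, div_le_one hp0]; exact hap
    have hl2 : p i * l ^ 2 = a := by
      rw [hl, Real.sq_sqrt (by positivity)]; field_simp
    have hpa : √(p i * a) = p i * l := by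
      rw [← hl2, show p i * (p i * l ^ 2) = (p i * l) ^ 2 by ring, Real.sqrt_sq (by positivity)]
    have hsub : deviationSet p X I L i t n ⊆
        {ω | playCount I i t ω = n ∧
          l * (n * (p i + 2 * (p i * l))) ≤ l * onesCount X I i t ω} ∪
        {ω | playCount I i t ω = n ∧
          (-l) * (n * (p i - 2 * (p i * l))) ≤ (-l) * onesCount X I i t ω} := by
      rintro ω ⟨h1, h2⟩
      rw [← ha, hpa] at h2
      rcases lt_abs.1 h2 with h | h
      · left
        refine ⟨h1, ?_⟩
        gcongr
        have : p i + 2 * (p i * l) ≤ (onesCount X I i t ω : ℝ) / n := by linarith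
        rw [le_div_iff₀ hn0] at this
        linarith
      · right
        refine ⟨h1, ?_⟩
        have : (onesCount X I i t ω : ℝ) / n ≤ p i - 2 * (p i * l) := by linarith
        rw [div_le_iff₀ hn0] at this
        nlinarith
    have e1 : n * (p i * (Real.exp l - 1)) - l * (n * (p i + 2 * (p i * l))) ≤ -L := by
      have h1 := exp_le_one_add_add_sq (x := l) (by rw [abs_of_pos hl0]; exact hl1)
      have h2 : n * (p i * (Real.exp l - 1)) ≤ n * (p i * (l + l ^ 2)) := by gcongr
      calc _ ≤ n * (p i * (l + l ^ 2)) - l * (n * (p i + 2 * (p i * l))) := by linarith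
        _ = -(n * (p i * l ^ 2)) := by ring
        _ = -L := by rw [hl2, hna]
    have e2 : n * (p i * (Real.exp (-l) - 1)) - (-l) * (n * (p i - 2 * (p i * l))) ≤ -L := by
      have h1 := exp_le_one_add_add_sq (x := -l) (by rw [abs_neg, abs_of_pos hl0]; exact hl1)
      have h2 : n * (p i * (Real.exp (-l) - 1)) ≤ n * (p i * (-l + (-l) ^ 2)) := by gcongr
      calc _ ≤ n * (p i * (-l + (-l) ^ 2)) - (-l) * (n * (p i - 2 * (p i * l))) := by linarith
        _ = -(n * (p i * l ^ 2)) := by ring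
        _ = -L := by rw [hl2, hna]
    calc _ ≤ _ := measureReal_mono hsub
      _ ≤ _ := measureReal_union_le _ _
      _ ≤ Real.exp (-L) + Real.exp (-L) :=
        add_le_add ((measure_chernoff_le hX hI i _ _ t n).trans (Real.exp_le_exp.2 e1))
          ((measure_chernoff_le hX hI i _ _ t n).trans (Real.exp_le_exp.2 e2))
      _ = _ := by ring
  · have hsub : deviationSet p X I L i t n ⊆
        {ω | playCount I i t ω = n ∧
          1 * (n * (p i + 2 * a)) ≤ 1 * (onesCount X I i t ω : ℝ)} := by
      rintro ω ⟨h1, h2⟩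
      rw [← ha] at h2
      have hs := Real.sqrt_nonneg (p i * a)
      have h0 : 0 ≤ (onesCount X I i t ω : ℝ) / n := by positivity
      refine ⟨h1, ?_⟩
      rcases lt_abs.1 h2 with h | h
      · have : p i + 2 * a ≤ (onesCount X I i t ω : ℝ) / n := by linarith
        rw [le_div_iff₀ hn0] at this
        linarith
      · linarith
    have e1 : n * (p i * (Real.exp 1 - 1)) - 1 * (n * (p i + 2 * a)) ≤ -L := by
      have h1 := exp_le_one_add_add_sq (x := 1) (by simp)
      have h2 : n * (p i * (Real.exp 1 - 1)) ≤ n * (p i * (1 + 1 ^ 2)) := by gcongr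
      have h3 : n * p i ≤ n * a := by gcongr
      linarith
    have := (measureReal_mono hsub).trans
      ((measure_chernoff_le hX hI i _ _ t n).trans (Real.exp_le_exp.2 e1))
    have := Real.exp_pos (-L)
    linarith

end

/-! ### The series of failure probabilities. -/

/-- A discrete form of comparing `(x + 1) ^ (1 - α)` with the integral of `s ^ (1 - α)` over `[x, x
+ 1]`; the right side telescopes. -/
lemma rpow_one_sub_le {α : ℝ} (hα : 2 < α) {x : ℝ} (hx : 0 < x) :
    x * (x + 1) ^ (-α) ≤ (x ^ (2 - α) - (x + 1) ^ (2 - α)) / (α - 2) := by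
  have hx1 : 0 < x + 1 := by linarith
  have hr : 0 < α - 2 := by linarith
  have h1 : Real.log x ≤ Real.log (x + 1) - 1 / (x + 1) := by
    have := Real.log_le_sub_one_of_pos (div_pos hx hx1)
    rw [Real.log_div hx.ne' hx1.ne'] at this
    have e : x / (x + 1) - 1 = -(1 / (x + 1)) := by field_simp; ring
    linarith
  have h2 : (x + 1) ^ (2 - α) * (1 + (α - 2) / (x + 1)) ≤ x ^ (2 - α) := by
    rw [Real.rpow_def_of_pos hx1, Real.rpow_def_of_pos hx]
    calc _ ≤ Real.exp (Real.log (x + 1) * (2 - α)) * Real.exp ((α - 2) / (x + 1)) := by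
          gcongr
          have := Real.add_one_le_exp ((α - 2) / (x + 1))
          linarith
      _ = Real.exp ((Real.log (x + 1) - 1 / (x + 1)) * (2 - α)) := by
          rw [← Real.exp_add]; congr 1; ring
      _ ≤ _ := by
          apply Real.exp_le_exp.2
          nlinarith
  have h3 : (x + 1) ^ (2 - α) = (x + 1) * ((x + 1) * (x + 1) ^ (-α)) := by
    rw [sub_eq_add_neg, Real.rpow_add hx1, Real.rpow_two]; ring
  have h4 : 0 < (x + 1) ^ (-α) := Real.rpow_pos_of_pos hx1 _
  rw [le_div_iff₀ hr]
  have h5 : (x + 1) ^ (2 - α) * ((α - 2) / (x + 1)) = (α - 2) * ((x + 1) * (x + 1) ^ (-α)) := by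
    rw [h3]; field_simp
  have h6 : x * (x + 1) ^ (-α) ≤ (x + 1) * (x + 1) ^ (-α) := by gcongr; linarith
  nlinarith

lemma sum_mul_rpow_neg_le {α : ℝ} (hα : 2 < α) (t : ℕ) :
    ∑ τ ∈ Finset.range t, (τ : ℝ) * ((τ : ℝ) + 1) ^ (-α) ≤ 1 / (α - 2) := by
  have hr : 0 < α - 2 := by linarith
  have key : ∀ t : ℕ, ∑ τ ∈ Finset.range (t + 1), (τ : ℝ) * ((τ : ℝ) + 1) ^ (-α) ≤
      (1 - ((t : ℝ) + 1) ^ (2 - α)) / (α - 2) := by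
    intro t
    induction t with
    | zero => simp
    | succ t ih =>
      rw [Finset.sum_range_succ]
      have := rpow_one_sub_le hα (x := ((t + 1 : ℕ) : ℝ)) (by positivity)
      push_cast at this ⊢
      calc _ ≤ _ := add_le_add ih this
        _ = _ := by ring
  rcases t with _ | t
  · simp [hr.le]
  · refine (key t).trans ?_
    gcongr
    have : (0 : ℝ) < ((t : ℝ) + 1) ^ (2 - α) := Real.rpow_pos_of_pos (by positivity) _
    linarith

lemma log_six_div_delta (α : ℝ) (τ : ℕ) (hτ : 0 < τ) :
    Real.log (6 / (6 * (τ : ℝ) ^ (-α))) = α * Real.log τ := by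
  have h : (0 : ℝ) < τ := by exact_mod_cast hτ
  rw [div_mul_cancel_left₀ (by norm_num), Real.log_inv, Real.log_rpow h]
  ring

/-! ### From atypical rounds to the regret. -/

section

variable {K : ℕ} {p : Fin K → ℝ}

lemma binEntropy_le_bestEntropy (p : Fin K → ℝ) (i : Fin K) :
    Real.binEntropy (p i) ≤ bestEntropy p :=
  le_ciSup (f := fun i => Real.binEntropy (p i)) (Set.finite_range _).bddAbove i

lemma gap_nonneg (p : Fin K → ℝ) (i : Fin K) : 0 ≤ gap p i :=
  sub_nonneg.2 (binEntropy_le_bestEntropy p i)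

lemma exists_binEntropy_eq_bestEntropy [Nonempty (Fin K)] (p : Fin K → ℝ) :
    ∃ j, Real.binEntropy (p j) = bestEntropy p :=
  exists_eq_ciSup_of_finite (f := fun i => Real.binEntropy (p i))

lemma gap_le_log_two [Nonempty (Fin K)] (hp : ∀ i, 0 ≤ p i ∧ p i ≤ 1 / 2) (i : Fin K) :
    gap p i ≤ Real.log 2 := by
  obtain ⟨j, hj⟩ := exists_binEntropy_eq_bestEntropy p
  have h1 : Real.binEntropy (p j) ≤ Real.log 2 := Real.binEntropy_le_log_two
  have h2 := Real.binEntropy_nonneg (hp i).1 (by linarith [(hp i).2])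
  rw [gap, ← hj]
  linarith

variable {Ω : Type*} {mΩ : MeasurableSpace Ω} {P : Measure Ω} {ℱ : Filtration ℕ mΩ}
  {X : Fin K → ℕ → Ω → Bool} {I : ℕ → Ω → Fin K} {α β : ℝ}

lemma integrable_playCount [IsProbabilityMeasure P] (hI : ∀ t, Measurable[ℱ t] (I (t + 1)))
    (i : Fin K) (t : ℕ) : Integrable (fun ω => (playCount I i t ω : ℝ)) P := by
  refine Integrable.of_bound (C := t) ?_ (ae_of_all _ fun ω => ?_)
  · exact (measurable_from_top.comp
      ((measurable_playCount hI i t).mono (ℱ.le t) le_rfl)).aestronglyMeasurable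
  · rw [Real.norm_natCast]
    exact_mod_cast playCount_le I i t ω

lemma pseudoRegret_eq [IsProbabilityMeasure P] (hI : ∀ t, Measurable[ℱ t] (I (t + 1)))
    (p : Fin K → ℝ) (t : ℕ) :
    pseudoRegret P p I t = ∑ i with 0 < gap p i, (∫ ω, (playCount I i t ω : ℝ) ∂P) * gap p i := by
  have h1 : ∑ i, ∫ ω, (playCount I i t ω : ℝ) ∂P = t := by
    rw [← integral_finsetSum _ fun i _ => integrable_playCount hI i t]
    have : ∀ ω, ∑ i, (playCount I i t ω : ℝ) = t := fun ω => by
      exact_mod_cast sum_playCount I t ω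
    simp [this]
  have h2 : ∑ i with 0 < gap p i, (∫ ω, (playCount I i t ω : ℝ) ∂P) * gap p i =
      ∑ i, (∫ ω, (playCount I i t ω : ℝ) ∂P) * gap p i := by
    rw [Finset.sum_filter]
    refine Finset.sum_congr rfl fun i _ => ?_
    split_ifs with h
    · rfl
    · rw [le_antisymm (not_lt.1 h) (gap_nonneg p i), mul_zero]
  rw [h2, pseudoRegret, ← h1, Finset.sum_mul, ← Finset.sum_sub_distrib]
  refine Finset.sum_congr rfl fun i _ => ?_
  rw [gap]; ring

/-- After round `τ`, the empirical probability of arm `i` or of arm `j` is atypical. -/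
def atypicalSet (p : Fin K → ℝ) (X : Fin K → ℕ → Ω → Bool) (I : ℕ → Ω → Fin K) (α : ℝ)
    (i j : Fin K) (τ : ℕ) : Set Ω :=
  ⋃ n ∈ Finset.Icc 1 τ, deviationSet p X I (α * Real.log (τ + 1 : ℕ)) i τ n ∪
    deviationSet p X I (α * Real.log (τ + 1 : ℕ)) j τ n

lemma measurableSet_atypicalSet (hX : IsBernoulliSources P ℱ p X)
    (hI : ∀ t, Measurable[ℱ t] (I (t + 1))) (i j : Fin K) (τ : ℕ) :
    MeasurableSet (atypicalSet p X I α i j τ) :=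
  Finset.measurableSet_biUnion _ fun n _ =>
    (measurableSet_deviationSet hX hI _ i τ n).union (measurableSet_deviationSet hX hI _ j τ n)

lemma measure_atypicalSet_le [IsProbabilityMeasure P] (hX : IsBernoulliSources P ℱ p X)
    (hI : ∀ t, Measurable[ℱ t] (I (t + 1))) (hp : ∀ i, 0 ≤ p i) (hα : 0 < α) (i j : Fin K)
    (τ : ℕ) : P.real (atypicalSet p X I α i j τ) ≤ 4 * ((τ : ℝ) * ((τ : ℝ) + 1) ^ (-α)) := by
  have hexp : Real.exp (-(α * Real.log (τ + 1 : ℕ))) = ((τ : ℝ) + 1) ^ (-α) := by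
    rw [Real.rpow_def_of_pos (by positivity)]
    push_cast
    congr 1; ring
  calc _ ≤ ∑ n ∈ Finset.Icc 1 τ, P.real (deviationSet p X I (α * Real.log (τ + 1 : ℕ)) i τ n ∪
        deviationSet p X I (α * Real.log (τ + 1 : ℕ)) j τ n) :=
        measureReal_biUnion_finset_le _ _
    _ ≤ ∑ n ∈ Finset.Icc 1 τ, 4 * ((τ : ℝ) + 1) ^ (-α) := by
        refine Finset.sum_le_sum fun n hn => ?_
        have hn' := Finset.mem_Icc.1 hn
        have hL : 0 < α * Real.log (τ + 1 : ℕ) :=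
          mul_pos hα (Real.log_pos (by exact_mod_cast (by omega : 1 < τ + 1)))
        have h1 := measure_deviationSet_le hX hI hL i (hp i) τ n (by omega)
        have h2 := measure_deviationSet_le hX hI hL j (hp j) τ n (by omega)
        rw [hexp] at h1 h2
        have := measureReal_union_le (μ := P)
          (deviationSet p X I (α * Real.log (τ + 1 : ℕ)) i τ n)
          (deviationSet p X I (α * Real.log (τ + 1 : ℕ)) j τ n)
        linarith
    _ = _ := by simp; ring

lemma empProb_observed (X : Fin K → ℕ → Ω → Bool) (I : ℕ → Ω → Fin K) (i : Fin K) (t : ℕ)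
    (ω : Ω) : empProb (observed X I i t ω) (playCount I i t ω) =
      (onesCount X I i t ω : ℝ) / playCount I i t ω := rfl

lemma empProb_observed_nonneg (X : Fin K → ℕ → Ω → Bool) (I : ℕ → Ω → Fin K) (i : Fin K) (t : ℕ)
    (ω : Ω) : 0 ≤ empProb (observed X I i t ω) (playCount I i t ω) := by
  rw [empProb_observed]; positivity

lemma empProb_observed_le_one (X : Fin K → ℕ → Ω → Bool) (I : ℕ → Ω → Fin K) (i : Fin K) (t : ℕ)
    (ω : Ω) : empProb (observed X I i t ω) (playCount I i t ω) ≤ 1 := by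
  rw [empProb_observed]
  exact div_le_one_of_le₀ (by exact_mod_cast onesCount_le_playCount X I i t ω) (by positivity)

lemma abs_empProb_sub_le_of_notMem {i : Fin K} {τ : ℕ} {L : ℝ} {ω : Ω}
    (h : ω ∉ deviationSet p X I L i τ (playCount I i τ ω)) :
    |empProb (observed X I i τ ω) (playCount I i τ ω) - p i| ≤
      2 * √(p i * (L / playCount I i τ ω)) + 2 * (L / playCount I i τ ω) := by
  by_contra hc
  exact h ⟨rfl, not_le.1 hc⟩

lemma notMem_deviationSet_of_notMem {i j : Fin K} {τ : ℕ} {ω : Ω}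
    (h : ω ∉ atypicalSet p X I α i j τ) (hi : 1 ≤ playCount I i τ ω)
    (hj : 1 ≤ playCount I j τ ω) :
    ω ∉ deviationSet p X I (α * Real.log (τ + 1 : ℕ)) i τ (playCount I i τ ω) ∧
      ω ∉ deviationSet p X I (α * Real.log (τ + 1 : ℕ)) j τ (playCount I j τ ω) := by
  constructor <;> intro hc <;> apply h <;> rw [atypicalSet, Set.mem_iUnion₂]
  · exact ⟨_, Finset.mem_Icc.2 ⟨hi, playCount_le I i τ ω⟩, Or.inl hc⟩
  · exact ⟨_, Finset.mem_Icc.2 ⟨hj, playCount_le I j τ ω⟩, Or.inr hc⟩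

/-- Once a suboptimal arm has been played often enough, it is only played again if the empirical
probability of this arm or of a best arm is atypical. -/
lemma mem_atypicalSet_of_play (hp : ∀ i, 0 ≤ p i ∧ p i ≤ 1 / 2) (hα : 2 < α)
    (hβ : β ∈ Set.Ioo (0 : ℝ) 1)
    (hrun : IsUCBRun ℱ X 3 (fun Y n => Real.binEntropy (empProb Y n))
      (fun Y δ n => ucdBer (empProb Y n) δ n) (fun t => 6 * (t : ℝ) ^ (-α)) I)
    {i j : Fin K} (hi : 0 < gap p i) (hj : Real.binEntropy (p j) = bestEntropy p)
    {τ t : ℕ} (hτ : τ < t) {ω : Ω} (hI : I (τ + 1) ω = i) (h3 : 3 < playCount I i τ ω)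
    (hN : gammaBer α β (p i) (gap p i) t < playCount I i τ ω) :
    ω ∈ atypicalSet p X I α i j τ := by
  by_contra hω
  have hall : ∀ k, 3 ≤ playCount I k τ ω := by
    intro k
    by_contra hk
    have := hrun.initial τ ω ⟨k, not_le.1 hk⟩
    rw [hI] at this
    omega
  have harg := hrun.argmax τ ω hall j
  rw [hI] at harg
  -- More than three plays force `τ + 1 ≥ 5`, hence `L ≥ 2 log 5 ≥ 3`, as the linear threshold
  -- requires.
  have hτ4 : 4 ≤ τ := h3.trans_le (playCount_le I i τ ω)
  set L := α * Real.log (τ + 1 : ℕ) with hL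
  set δ := 6 * ((τ + 1 : ℕ) : ℝ) ^ (-α) with hδ
  have hLδ : Real.log (6 / δ) = L := log_six_div_delta α (τ + 1) (by omega)
  have hL3 : 3 ≤ L := by
    have h5 : (3 : ℝ) / 2 ≤ Real.log (τ + 1 : ℕ) := by
      have h6 : Real.log 5 ≤ Real.log (τ + 1 : ℕ) :=
        Real.log_le_log (by norm_num) (by exact_mod_cast (by omega : 5 ≤ τ + 1))
      have h7 : 3 ≤ 2 * Real.log 5 := by
        rw [show 2 * Real.log 5 = Real.log (5 ^ 2) by rw [Real.log_pow]; norm_num,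
          Real.le_log_iff_exp_le (by norm_num), show (3 : ℝ) = 1 + 1 + 1 by norm_num,
          Real.exp_add, Real.exp_add]
        have := Real.exp_one_lt_d9
        have := Real.exp_pos 1
        calc Real.exp 1 * Real.exp 1 * Real.exp 1 ≤ 2.72 * 2.72 * 2.72 := by gcongr <;> linarith
          _ ≤ _ := by norm_num
      linarith
    nlinarith
  have hLt : L ≤ α * Real.log t := by
    have : ((τ + 1 : ℕ) : ℝ) ≤ t := by exact_mod_cast hτ
    rw [hL]
    gcongr
  obtain ⟨hdi, hdj⟩ := notMem_deviationSet_of_notMem hω (by have := hall i; omega)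
    (by have := hall j; omega)
  have hei := abs_le.1 (abs_empProb_sub_le_of_notMem hdi)
  have hej := abs_le.1 (abs_empProb_sub_le_of_notMem hdj)
  rw [← hL] at hei hej
  have hopt := binEntropy_le_add_ucdBer (δ := δ) (by rw [hLδ]) (hall j)
    (by linarith) (hp j).1 (hp j).2 (empProb_observed_nonneg X I j τ ω)
    (empProb_observed_le_one X I j τ ω) (by linarith [hej.1]) (by linarith [hej.2])
  have : Nonempty (Fin K) := ⟨i⟩
  have hsub := binEntropy_add_ucdBer_lt (δ := δ) (L := α * Real.log t) (by rw [hLδ]) (hall i) (by linarith)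
    (by rw [hLδ]; exact hLt) (hp i).1 (hp i).2 (empProb_observed_nonneg X I i τ ω)
    (empProb_observed_le_one X I i τ ω) (by linarith [hei.2]) hβ.1 hβ.2 hi (gap_le_log_two hp i)
    (by
      refine lt_of_le_of_lt ?_ hN
      rw [← mul_assoc]
      exact le_max_left _ _)
    (by
      refine lt_of_le_of_lt ?_ hN
      rw [← mul_assoc]
      exact (le_max_left _ _).trans (le_max_right _ _))
  rw [gap] at hsub
  linarith

/-- Induction on `s` at a fixed horizon `t`: a play from a count at most `max Γ 3` leaves it at most
one larger, and every later play is charged to an atypical round. -/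
lemma playCount_le_add_sum (hp : ∀ i, 0 ≤ p i ∧ p i ≤ 1 / 2) (hα : 2 < α)
    (hβ : β ∈ Set.Ioo (0 : ℝ) 1)
    (hrun : IsUCBRun ℱ X 3 (fun Y n => Real.binEntropy (empProb Y n))
      (fun Y δ n => ucdBer (empProb Y n) δ n) (fun t => 6 * (t : ℝ) ^ (-α)) I)
    {i j : Fin K} (hi : 0 < gap p i) (hj : Real.binEntropy (p j) = bestEntropy p)
    {t s : ℕ} (hs : s ≤ t) (ω : Ω) :
    (playCount I i s ω : ℝ) ≤ max (gammaBer α β (p i) (gap p i) t) 3 + 1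
      + ∑ τ ∈ Finset.range s, (atypicalSet p X I α i j τ).indicator 1 ω := by
  have h0 : ∀ τ, (0 : ℝ) ≤ (atypicalSet p X I α i j τ).indicator 1 ω := fun τ =>
    Set.indicator_nonneg (fun _ _ => zero_le_one) ω
  induction s with
  | zero =>
    have := le_max_right (gammaBer α β (p i) (gap p i) t) 3
    simp [playCount_zero]
    linarith
  | succ s ih =>
    have ih := ih (by omega)
    rw [Finset.sum_range_succ, playCount_succ]
    push_cast
    by_cases hI : I (s + 1) ω = i
    · rw [if_pos hI]
      rcases le_or_gt (playCount I i s ω : ℝ) (max (gammaBer α β (p i) (gap p i) t) 3) with h | h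
      · have := Finset.sum_nonneg fun τ (_ : τ ∈ Finset.range s) => h0 τ
        have := h0 s
        linarith
      · have hmem := mem_atypicalSet_of_play hp hα hβ hrun hi hj (by omega : s < t) hI
          (by exact_mod_cast (le_max_right _ _).trans_lt h) ((le_max_left _ _).trans_lt h)
        rw [Set.indicator_of_mem hmem]
        simp only [Pi.one_apply]
        linarith
    · rw [if_neg hI]
      have := h0 s
      linarith

lemma log_div_sq_mul_sq_nonneg {Δ : ℝ} (hβ : β ∈ Set.Ioo (0 : ℝ) 1) (hΔ0 : 0 < Δ)
    (hΔ : Δ ≤ Real.log 2) : 0 ≤ Real.log (48 / (β ^ 2 * Δ ^ 2)) := by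
  have hlog2 := Real.log_two_lt_d9
  have h1 : β ^ 2 * Δ ^ 2 ≤ 1 * 1 := by
    gcongr
    · exact pow_le_one₀ hβ.1.le hβ.2.le
    · exact pow_le_one₀ hΔ0.le (by linarith)
  have h2 : 0 < β ^ 2 * Δ ^ 2 := by have := hβ.1; positivity
  apply Real.log_nonneg
  rw [le_div_iff₀ h2]
  linarith

lemma gammaBer_nonneg {q Δ : ℝ} (hβ : β ∈ Set.Ioo (0 : ℝ) 1) (hΔ0 : 0 < Δ)
    (hΔ : Δ ≤ Real.log 2) (t : ℕ) : 0 ≤ gammaBer α β q Δ t := by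
  -- The third entry of the maximum is nonnegative whatever the sign of `q`.
  refine le_trans ?_ ((le_max_right _ _).trans (le_max_right _ _))
  have := log_div_sq_mul_sq_nonneg hβ hΔ0 hΔ
  have := hβ.1
  positivity

/-- The constant is `3 + 1 + 4 / (α - 2)`: initial plays, one overshoot, atypical rounds. -/
lemma integral_playCount_le [IsProbabilityMeasure P] (hX : IsBernoulliSources P ℱ p X)
    (hp : ∀ i, 0 ≤ p i ∧ p i ≤ 1 / 2) (hα : 2 < α) (hβ : β ∈ Set.Ioo (0 : ℝ) 1)
    (hrun : IsUCBRun ℱ X 3 (fun Y n => Real.binEntropy (empProb Y n))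
      (fun Y δ n => ucdBer (empProb Y n) δ n) (fun t => 6 * (t : ℝ) ^ (-α)) I)
    {i : Fin K} (hi : 0 < gap p i) (t : ℕ) :
    ∫ ω, (playCount I i t ω : ℝ) ∂P ≤
      gammaBer α β (p i) (gap p i) t + 4 * (α - 1) / (α - 2) := by
  have : Nonempty (Fin K) := ⟨i⟩
  obtain ⟨j, hj⟩ := exists_binEntropy_eq_bestEntropy p
  have hm := fun τ => measurableSet_atypicalSet (α := α) hX hrun.predictable i j τ
  have hint : ∀ τ, Integrable ((atypicalSet p X I α i j τ).indicator (1 : Ω → ℝ)) P :=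
    fun τ => (integrable_const (1 : ℝ)).indicator (hm τ)
  have hΓ := gammaBer_nonneg (α := α) (q := p i) hβ hi (gap_le_log_two hp i) t
  have hmax : max (gammaBer α β (p i) (gap p i) t) 3 ≤ gammaBer α β (p i) (gap p i) t + 3 :=
    max_le (by linarith) (by linarith)
  calc _ ≤ ∫ ω, (max (gammaBer α β (p i) (gap p i) t) 3 + 1
        + ∑ τ ∈ Finset.range t, (atypicalSet p X I α i j τ).indicator 1 ω) ∂P := by
        refine integral_mono (integrable_playCount hrun.predictable i t)
          ((integrable_const _).add (integrable_finsetSum _ fun τ _ => hint τ)) fun ω => ?_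
        exact playCount_le_add_sum hp hα hβ hrun hi hj le_rfl ω
    _ = max (gammaBer α β (p i) (gap p i) t) 3 + 1
        + ∑ τ ∈ Finset.range t, P.real (atypicalSet p X I α i j τ) := by
        rw [integral_add (integrable_const _) (integrable_finsetSum _ fun τ _ => hint τ),
          integral_finsetSum _ fun τ _ => hint τ]
        simp only [integral_const, probReal_univ, one_smul, integral_indicator_one (hm _)]
    _ ≤ max (gammaBer α β (p i) (gap p i) t) 3 + 1
        + ∑ τ ∈ Finset.range t, 4 * ((τ : ℝ) * ((τ : ℝ) + 1) ^ (-α)) := by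
        gcongr with τ
        exact measure_atypicalSet_le hX hrun.predictable (fun i => (hp i).1) (by linarith) i j τ
    _ ≤ gammaBer α β (p i) (gap p i) t + 3 + 1 + 4 * (1 / (α - 2)) := by
        rw [← Finset.mul_sum]
        gcongr
        exact sum_mul_rpow_neg_le hα t
    _ = _ := by
        have : α - 2 ≠ 0 := by linarith
        field_simp
        ring

end

/-! ### The leading term for small gaps. -/

/-- The maximum exceeds its second entry by at most the sum of bounds on the other two. With `R =
log t / Δ`, both are `O(R log R)`: `log R ≥ 0.3` absorbs constants and `-log Δ ≤ log R`. -/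
lemma gammaBer_sub_le {α β : ℝ} (hα : 2 < α) (hβ : β ∈ Set.Ioo (0 : ℝ) 1) {t : ℕ} (ht : 3 ≤ t)
    {q Δ : ℝ} (hq : 0 ≤ q) (hΔ0 : 0 < Δ) (hΔ : Δ ≤ Real.log 2) :
    |gammaBer α β q Δ t - 5120 * α / β ^ 2 * (q * Real.log t / Δ ^ 2)
        * Real.log (48 / (β ^ 2 * Δ ^ 2)) ^ 2| ≤
      (216 * α / (1 - β) * (|Real.log (36 * α / (1 - β))| / 0.3 + 1)
          + 88 * α / β * (Real.log (48 / β ^ 2) / 0.3 + 2))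
        * (Real.log t / Δ) * Real.log (Real.log t / Δ) := by
  obtain ⟨hβ0, hβ1⟩ := hβ
  have h1β : 0 < 1 - β := by linarith
  have ht3 : (3 : ℝ) ≤ t := by exact_mod_cast ht
  have hl1 := one_le_log_of_three_le ht3
  set l := Real.log t with hl
  have hlog2 : Real.log 2 < 0.7 := by have := Real.log_two_lt_d9; linarith
  set R := l / Δ with hR
  have hR1 : 1 / 0.7 ≤ R := by
    rw [hR]; gcongr; linarith
  have hR0 : 0 < R := by positivity
  have hlR : 0.3 ≤ Real.log R := by
    have := Real.one_sub_inv_le_log_of_pos hR0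
    have h2 : R⁻¹ ≤ 0.7 := by
      rw [inv_le_comm₀ hR0 (by norm_num)]; simpa using hR1
    linarith
  have hlΔ : -Real.log Δ ≤ Real.log R := by
    rw [hR, Real.log_div (by positivity) hΔ0.ne']
    have := Real.log_nonneg hl1
    linarith
  have hlarge := log_div_sq_mul_sq_nonneg ⟨hβ0, hβ1⟩ hΔ0 hΔ
  have h48 : 0 ≤ Real.log (48 / β ^ 2) := by
    apply Real.log_nonneg
    rw [le_div_iff₀ (by positivity)]
    nlinarith
  have hscale : ∀ {c : ℝ}, 0 ≤ c → c ≤ c / 0.3 * Real.log R := by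
    intro c hc
    rw [div_mul_eq_mul_div, le_div_iff₀ (by norm_num)]
    gcongr
  have e : 5120 * α / β ^ 2 * (q * l / Δ ^ 2) * Real.log (48 / (β ^ 2 * Δ ^ 2)) ^ 2 =
      5120 * q * α * l / (β ^ 2 * Δ ^ 2) * Real.log (48 / (β ^ 2 * Δ ^ 2)) ^ 2 := by
    field_simp
  set A := 216 * α / (1 - β) * (|Real.log (36 * α / (1 - β))| / 0.3 + 1) * R * Real.log R with hA
  set B := 88 * α / β * (Real.log (48 / β ^ 2) / 0.3 + 2) * R * Real.log R with hB
  have hA0 : 0 ≤ A := by positivity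
  have hB0 : 0 ≤ B := by positivity
  have hT1 : 6 * polylogLin 1 (36 * α * l / ((1 - β) * Δ)) ≤ A := by
    have e1 : 36 * α * l / ((1 - β) * Δ) = 36 * α / (1 - β) * R := by
      rw [hR]; field_simp
    rw [polylogLin, pow_one, e1, Real.log_mul (by positivity) hR0.ne']
    have h1 := (le_abs_self (Real.log (36 * α / (1 - β)))).trans (hscale (abs_nonneg _))
    calc _ ≤ 6 * (36 * α / (1 - β) * R *
          (|Real.log (36 * α / (1 - β))| / 0.3 * Real.log R + Real.log R)) := by gcongr
      _ = A := by rw [hA]; ring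
  have hT3 : 88 * √(α * l) / (β * Δ) * Real.log (48 / (β ^ 2 * Δ ^ 2)) ≤ B := by
    have h1 : √(α * l) ≤ α * l := by
      rw [Real.sqrt_le_left (by positivity)]
      have : 1 ≤ α * l := by nlinarith
      nlinarith
    have h2 : Real.log (48 / (β ^ 2 * Δ ^ 2)) ≤
        (Real.log (48 / β ^ 2) / 0.3 + 2) * Real.log R := by
      rw [← div_div, Real.log_div (by positivity) (by positivity), Real.log_pow]
      have := hscale h48
      push_cast
      linarith
    calc _ ≤ 88 * (α * l) / (β * Δ) * ((Real.log (48 / β ^ 2) / 0.3 + 2) * Real.log R) := by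
          gcongr
      _ = B := by rw [hB, hR]; field_simp
  have hAB : (216 * α / (1 - β) * (|Real.log (36 * α / (1 - β))| / 0.3 + 1)
      + 88 * α / β * (Real.log (48 / β ^ 2) / 0.3 + 2)) * R * Real.log R = A + B := by
    rw [hA, hB]; ring
  rw [hAB, e, gammaBer]
  have hT2 : 0 ≤ 5120 * q * α * l / (β ^ 2 * Δ ^ 2) * Real.log (48 / (β ^ 2 * Δ ^ 2)) ^ 2 := by
    positivity
  rw [abs_of_nonneg (sub_nonneg.2 ((le_max_left _ _).trans (le_max_right _ _))),
    sub_le_iff_le_add]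
  refine max_le ?_ (max_le ?_ ?_) <;> linarith

theorem theorem6 :
    -- the regret bound
    (∀ {Ω : Type*} {mΩ : MeasurableSpace Ω} (P : Measure Ω) [IsProbabilityMeasure P]
        (ℱ : Filtration ℕ mΩ) (K : ℕ) (_ : 2 ≤ K)
        (p : Fin K → ℝ) (_ : ∀ i, 0 ≤ p i ∧ p i ≤ 1 / 2)
        (X : Fin K → ℕ → Ω → Bool) (_ : IsBernoulliSources P ℱ p X)
        (α : ℝ) (_ : 2 < α)
        (I : ℕ → Ω → Fin K)
        (_ : IsUCBRun ℱ X 3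
          (fun Y n => Real.binEntropy (empProb Y n))
          (fun Y δ n => ucdBer (empProb Y n) δ n)
          (fun t => 6 * (t : ℝ) ^ (-α)) I)
        (t : ℕ) (_ : 1 ≤ t),
        pseudoRegret P p I t ≤
          ∑ i with 0 < gap p i, ⨅ β : Set.Ioo (0 : ℝ) 1,
            (gammaBer α β (p i) (gap p i) t * gap p i
              + 16 * (α - 1) / (α - 2) * gap p i)) ∧
    -- the leading term of the bound for small gaps
    (∀ (α : ℝ) (_ : 2 < α) (β : ℝ) (_ : β ∈ Set.Ioo (0 : ℝ) 1),
      ∃ C : ℝ, ∀ (t : ℕ) (_ : 3 ≤ t) (q : ℝ) (_ : 0 ≤ q ∧ q ≤ 1 / 2)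
        (Δ : ℝ) (_ : 0 < Δ ∧ Δ ≤ Real.log 2),
        |gammaBer α β q Δ t
            - 5120 * α / β ^ 2 * (q * Real.log t / Δ ^ 2)
              * Real.log (48 / (β ^ 2 * Δ ^ 2)) ^ 2| ≤
          C * (Real.log t / Δ) * Real.log (Real.log t / Δ)) := by
  refine ⟨?_, fun α hα β hβ => ⟨_, fun t ht q hq Δ hΔ => gammaBer_sub_le hα hβ ht hq.1 hΔ.1 hΔ.2⟩⟩
  intro Ω mΩ P _ ℱ K _ p hp X hX α hα I hrun t _
  rw [pseudoRegret_eq hrun.predictable]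
  refine Finset.sum_le_sum fun i hi => ?_
  have hi : 0 < gap p i := (Finset.mem_filter.1 hi).2
  have : Nonempty (Set.Ioo (0 : ℝ) 1) := ⟨⟨1 / 2, by norm_num, by norm_num⟩⟩
  refine le_ciInf fun β => ?_
  have h1 := integral_playCount_le hX hp hα β.2 hrun hi t
  have h2 : 4 * (α - 1) / (α - 2) ≤ 16 * (α - 1) / (α - 2) := by
    have : 0 < α - 2 := by linarith
    gcongr
    · linarith
    · norm_num
  calc _ ≤ (gammaBer α β (p i) (gap p i) t + 16 * (α - 1) / (α - 2)) * gap p i := by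
        gcongr
        linarith
    _ = _ := by ring
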